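/- Let $A$ be a unital separable C$^*$-algebra that is approximately divisible: for all $x_1,\dots,x_n\in A$ and every $\varepsilon>0$ there is a finite-dimensional C$^*$-subalgebra $B\subseteq A$ containing the unit of $A$, with $B\cong M_{k_1}(\mathbb C)\oplus\cdots\oplus M_{k_r}(\mathbb C)$ for some $r\ge 1$ and $\min\{k_1,\dots,k_r\}\ge 2$, such that $\|x_iy-yx_i\|<\varepsilon$ for $i=1,\dots,n$ and all $y\in B$ with $\|y\|\le 1$. Then $A$ is singly generated, i.e. there is $x\in A$ such that $A$ is the smallest norm-closed $*$-subalgebra of $A$ containing $x$; equivalently, there are self-adjoint elements $a,b\in A$ such that $A$ is the smallest norm-closed $*$-subalgebra of $A$ containing $a$ and $b$. -/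

import Mathlib

/-- `HasSubrank B m`: there are positive integers `r, k₁, …, k_r` such that `B` is *-isomorphic
to `M_{k₁}(ℂ) ⊕ ⋯ ⊕ M_{k_r}(ℂ)`, and `m = min {k₁, …, k_r}`.
(The existence of a least element forces `r` to be positive.) -/
def HasSubrank (B : Type*) [Semiring B] [Algebra ℂ B] [Star B] (m : ℕ) : Prop :=
  ∃ (r : ℕ) (k : Fin r → ℕ), (∀ i, 0 < k i) ∧
    Nonempty (B ≃⋆ₐ[ℂ] ((i : Fin r) → Matrix (Fin (k i)) (Fin (k i)) ℂ)) ∧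
    IsLeast (Set.range k) m

/-- The subrank `min {k₁, …, k_r}` of a nonzero finite-dimensional C*-algebra
`B ≅ M_{k₁}(ℂ) ⊕ ⋯ ⊕ M_{k_r}(ℂ)`. The sizes `k₁, …, k_r` are unique up to order, so the set below
has one element; it is empty, and the value is `0`, if `B` has no such decomposition. -/
noncomputable def subRank (B : Type*) [Semiring B] [Algebra ℂ B] [Star B] : ℕ :=
  sInf {m : ℕ | HasSubrank B m}

/-- Approximate divisibility of a unital C*-algebra `A` (used for separable `A`).
A `StarSubalgebra` contains the unit of `A`, and a finite-dimensional one is automatically closed,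
so `B` below ranges over the finite-dimensional C*-subalgebras containing the unit of `A`. -/
def IsApproximatelyDivisible (A : Type*) [CStarAlgebra A] : Prop :=
  ∀ (n : ℕ) (x : Fin n → A) (ε : ℝ), 0 < ε →
    ∃ B : StarSubalgebra ℂ A, FiniteDimensional ℂ B ∧ 2 ≤ subRank B ∧
      ∀ i : Fin n, ∀ y ∈ B, ‖y‖ ≤ 1 → ‖x i * y - y * x i‖ < ε

/-- The C*-subalgebra `C*(S)` of `A` generated by `S`: the smallest norm-closed *-subalgebra
containing `S`. It is not required to contain the unit of `A`. -/
noncomputable def cstarGenerated {A : Type*} [CStarAlgebra A] (S : Set A) : NonUnitalStarSubalgebra ℂ A :=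
  (NonUnitalStarAlgebra.adjoin ℂ S).topologicalClosure

/-- `A` is singly generated if it is generated as a C*-algebra by one element. -/
def IsSinglyGenerated (A : Type*) [CStarAlgebra A] : Prop :=
  ∃ x : A, cstarGenerated ({x} : Set A) = ⊤

/-! The proof is a Baire category argument in the closure of the set of self-adjoint pairs `(a, b)`
with `a` of finite spectrum. For a dense sequence `c n`, the pairs in which some noncommutative
polynomial comes close to `(c n + star (c n))²` form an open set. Once these sets are dense, one
pair serves all of them. The closed algebra it generates contains all squares of self-adjoint
elements, hence everything by polarisation with `1`.

Density is `IsApproximatelyDivisible.exists_perturbation`. Given `a`, `b` and a self-adjoint `x`,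
average them over a finite unitary group spanning the matrix algebra `B` to get nearby `a₁`, `b₁`,
`y` commuting exactly with `B`. Rounding the spectrum of `a₁` restores finiteness and keeps
commutation. Adding a small combination of the diagonal projections `e i` of `B` puts every `e i` in
the algebra of the new `a'`. As all blocks have size at least two, `B` has a self-adjoint `w` with
zero diagonal and `w²` of diagonal `1`. Put `b' = b₁ + δ y w`. Compression by the `e i` turns `b'`
into `b₁`, which frees `y w`, and turns `(y w)² = y² w²` into `y²`, close to `x²`. -/

section MatrixProducts

/-! ### Sums of matrix algebras: a finite generating group of unitaries, and the off-diagonal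
element. -/

variable {r : ℕ} (k : Fin r → ℕ)

/-- The product algebra `M_{k₁}(ℂ) ⊕ ⋯ ⊕ M_{k_r}(ℂ)`. -/
abbrev MatrixProd : Type := (i : Fin r) → Matrix (Fin (k i)) (Fin (k i)) ℂ

/-- The elements of `MatrixProd k` all of whose entries are integers. -/
def integralSubring : Subring (MatrixProd k) where
  carrier := {m | ∀ i, m i ∈ ((Int.castRingHom ℂ).range.matrix : Subring (Matrix (Fin (k i)) _ ℂ))}
  mul_mem' hx hy i := mul_mem (hx i) (hy i)
  one_mem' _ := one_mem _
  add_mem' hx hy i := add_mem (hx i) (hy i)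
  zero_mem' _ := zero_mem _
  neg_mem' hx i := neg_mem (hx i)

/-- The group of unitaries of `MatrixProd k` with integer entries. -/
def integralUnitary : Subgroup (unitary (MatrixProd k)) where
  carrier := {u | (u : MatrixProd k) ∈ integralSubring k ∧ star (u : MatrixProd k) ∈ integralSubring k}
  mul_mem' := by
    rintro x y ⟨hx, hx'⟩ ⟨hy, hy'⟩
    exact ⟨mul_mem hx hy, by simpa using mul_mem hy' hx'⟩
  one_mem' := ⟨one_mem _, by simp [one_mem]⟩
  inv_mem' := by
    rintro x ⟨hx, hx'⟩
    exact ⟨by simpa [← Unitary.star_eq_inv] using hx', by simpa [← Unitary.star_eq_inv] using hx⟩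

/-- Entries of a unitary have modulus at most one, so integer entries lie in `{-1, 0, 1}`.
Finiteness lets averages be finite sums rather than Haar integrals. -/
instance : Finite (integralUnitary k) := by
  have hfin : (Set.univ.pi fun i : Fin r => Set.univ.pi fun _ : Fin (k i) =>
      Set.univ.pi fun _ : Fin (k i) => (fun n : ℤ => (n : ℂ)) '' Set.Icc (-1) 1).Finite :=
    Set.Finite.pi fun i => Set.Finite.pi fun _ => Set.Finite.pi fun _ =>
      (Set.finite_Icc _ _).image _
  have := hfin.to_subtype
  refine Finite.of_injective (β := (Set.univ.pi fun i : Fin r => Set.univ.pi fun _ : Fin (k i) =>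
      Set.univ.pi fun _ : Fin (k i) => (fun n : ℤ => (n : ℂ)) '' Set.Icc (-1) 1))
    (fun u => ⟨(u : unitary (MatrixProd k)).1, ?_⟩) ?_
  · intro i _ a _ b _
    obtain ⟨n, hn⟩ := u.2.1 i a b
    refine ⟨n, ?_, by simpa using hn⟩
    have hu : (u : unitary (MatrixProd k)).1 i ∈ Matrix.unitaryGroup (Fin (k i)) ℂ := by
      have h := u.1.2
      rw [Unitary.mem_iff] at h
      exact Unitary.mem_iff.2 ⟨congrFun h.1 i, congrFun h.2 i⟩
    have h1 := entry_norm_bound_of_unitary hu a b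
    rw [← hn] at h1
    simp only [eq_intCast, Complex.norm_intCast] at h1
    have h2 : |n| ≤ 1 := by exact_mod_cast h1
    exact abs_le.1 h2
  · intro u v h
    have h' : (u : unitary (MatrixProd k)).1 = (v : unitary (MatrixProd k)).1 :=
      Subtype.mk.inj h
    exact Subtype.ext (Subtype.ext h')

/-- The matrix units of `MatrixProd k`. -/
def matUnit (i : Fin r) (a b : Fin (k i)) : MatrixProd k := Pi.single i (Matrix.single a b 1)

variable {k}

lemma matUnit_mul_same (i : Fin r) (a b c : Fin (k i)) :
    matUnit k i a b * matUnit k i b c = matUnit k i a c := by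
  simp [matUnit, ← Pi.single_mul]

lemma matUnit_mul_of_ne (i : Fin r) (a b b' c : Fin (k i)) (h : b ≠ b') :
    matUnit k i a b * matUnit k i b' c = 0 := by
  simp [matUnit, ← Pi.single_mul, h]

lemma matUnit_mul_of_block_ne {i i' : Fin r} (h : i ≠ i') (a b : Fin (k i)) (c d : Fin (k i')) :
    matUnit k i a b * matUnit k i' c d = 0 := by
  ext j : 1
  by_cases hj : j = i
  · subst hj; simp [matUnit, Pi.single_eq_of_ne h]
  · simp [matUnit, Pi.single_eq_of_ne hj]

lemma star_matUnit (i : Fin r) (a b : Fin (k i)) :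
    star (matUnit k i a b) = matUnit k i b a := by
  simp [matUnit, Matrix.star_eq_conjTranspose]

lemma matUnit_mem_integralSubring (i : Fin r) (a b : Fin (k i)) :
    matUnit k i a b ∈ integralSubring k := by
  intro j
  by_cases hj : j = i
  · subst hj
    intro c d
    simp only [matUnit, Pi.single_eq_same, Matrix.single_apply]
    split_ifs
    exacts [Subring.one_mem (Int.castRingHom ℂ).range, Subring.zero_mem (Int.castRingHom ℂ).range]
  · rw [matUnit, Pi.single_eq_of_ne hj]
    exact zero_mem (Subring.matrix _)

lemma eq_sum_matUnit (m : MatrixProd k) :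
    m = ∑ i, ∑ a, ∑ b, m i a b • matUnit k i a b := by
  ext j : 1
  rw [Finset.sum_apply, Finset.sum_eq_single j]
  · conv_lhs => rw [Matrix.matrix_eq_sum_single (m j)]
    simp [matUnit, Finset.sum_apply, Matrix.smul_single]
  · intro i _ hi
    simp [matUnit, Finset.sum_apply, Pi.single_eq_of_ne hi.symm]
  · simp

lemma mem_integralUnitary_of_isSelfAdjoint {u : MatrixProd k} (hs : star u = u) (hu : u * u = 1)
    (hi : u ∈ integralSubring k) : ∃ v ∈ integralUnitary k, (v : MatrixProd k) = u :=
  ⟨⟨u, Unitary.mem_iff.2 ⟨by rw [hs, hu], by rw [hs, hu]⟩⟩, ⟨hi, by simpa [hs] using hi⟩, rfl⟩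

/-- The unitaries with integer entries generate the whole algebra. -/
lemma eq_top_of_integralUnitary_le (S : Subalgebra ℂ (MatrixProd k))
    (hS : ∀ u ∈ integralUnitary k, (u : MatrixProd k) ∈ S) : S = ⊤ := by
  have hdiag (i : Fin r) (a : Fin (k i)) : matUnit k i a a ∈ S := by
    have hE := matUnit_mul_same i a a a
    -- With `E` the diagonal unit, the reflection `1 - 2E` is an integral unitary, and it determines
    -- `E`.
    obtain ⟨v, hv, hvu⟩ := mem_integralUnitary_of_isSelfAdjoint
      (u := 1 - (matUnit k i a a + matUnit k i a a)) (by simp [star_matUnit])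
      (by simp only [mul_sub, sub_mul, mul_add, add_mul, hE, one_mul, mul_one]; abel)
      (sub_mem (one_mem _) (add_mem (matUnit_mem_integralSubring i a a)
        (matUnit_mem_integralSubring i a a)))
    have h := hS v hv
    rw [hvu] at h
    have h2 := S.smul_mem (sub_mem S.one_mem h) (1 / 2 : ℂ)
    rwa [sub_sub_cancel, ← two_smul ℂ (matUnit k i a a), smul_smul, one_div,
      inv_mul_cancel₀ two_ne_zero, one_smul] at h2
  have hall (i : Fin r) (a b : Fin (k i)) : matUnit k i a b ∈ S := by
    by_cases hab : a = b
    · exact hab ▸ hdiag i a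
    have hba : b ≠ a := Ne.symm hab
    -- This `u` is the permutation matrix swapping `a` and `b` in block `i`; its product with the
    -- diagonal unit at `a` is the unit at `(a, b)`.
    obtain ⟨v, hv, hvu⟩ := mem_integralUnitary_of_isSelfAdjoint
      (u := 1 - (matUnit k i a a + matUnit k i b b - matUnit k i a b - matUnit k i b a))
      (by simp only [star_sub, star_add, star_one, star_matUnit]; abel)
      (by
        simp only [mul_sub, sub_mul, mul_add, add_mul, matUnit_mul_same, one_mul, mul_one,
          matUnit_mul_of_ne i _ _ _ _ hab, matUnit_mul_of_ne i _ _ _ _ hba]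
        abel)
      (sub_mem (one_mem _) (sub_mem (sub_mem (add_mem (matUnit_mem_integralSubring i a a)
        (matUnit_mem_integralSubring i b b)) (matUnit_mem_integralSubring i a b))
        (matUnit_mem_integralSubring i b a)))
    have h := S.mul_mem (hdiag i a) (hS v hv)
    rw [hvu] at h
    simpa only [mul_sub, mul_add, matUnit_mul_same, mul_one, matUnit_mul_of_ne i _ _ _ _ hab,
      add_zero, sub_zero, sub_sub_cancel, sub_sub_cancel_left, sub_self, zero_sub, neg_neg] using h
  refine eq_top_iff.2 fun m _ => ?_
  rw [eq_sum_matUnit m]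
  exact S.sum_mem fun i _ => S.sum_mem fun a _ => S.sum_mem fun b _ => S.smul_mem (hall i a b) _

/-- The minimal diagonal projections. -/
def diagUnit (k : Fin r → ℕ) (s : Σ i, Fin (k i)) : MatrixProd k := matUnit k s.1 s.2 s.2

lemma completeOrthogonalIdempotents_diagUnit :
    CompleteOrthogonalIdempotents (diagUnit k) where
  idem s := matUnit_mul_same _ _ _ _
  ortho := by
    rintro ⟨i, a⟩ ⟨j, b⟩ h
    by_cases hij : i = j
    · subst hij
      exact matUnit_mul_of_ne _ _ _ _ _ (by rintro rfl; exact h rfl)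
    · exact matUnit_mul_of_block_ne hij _ _ _ _
  complete := by
    rw [eq_sum_matUnit 1, Fintype.sum_sigma]
    refine Finset.sum_congr rfl fun i _ => Finset.sum_congr rfl fun a _ => ?_
    rw [Finset.sum_eq_single a]
    · simp [diagUnit]
    · intro b _ hb; simp [Matrix.one_apply_ne hb.symm]
    · simp

lemma sum_diagUnit_mul_mul_diagUnit (m : MatrixProd k) :
    ∑ s, diagUnit k s * m * diagUnit k s = fun i => Matrix.diagonal (m i).diag := by
  ext j : 1
  rw [Fintype.sum_sigma, Finset.sum_apply, Finset.sum_eq_single j]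
  · ext a b
    simp only [diagUnit, matUnit, Finset.sum_apply, Pi.mul_apply, Pi.single_eq_same,
      Matrix.sum_apply, Matrix.diagonal_apply, Matrix.diag_apply]
    simp only [Matrix.single_mul_mul_single, one_mul, mul_one, Matrix.single_apply]
    by_cases hab : a = b
    · subst hab; simp
    · rw [if_neg hab]
      refine Finset.sum_eq_zero fun c _ => if_neg ?_
      rintro ⟨rfl, rfl⟩; exact hab rfl
  · intro i _ hi
    simp [diagUnit, matUnit, Finset.sum_apply, Pi.single_eq_of_ne hi.symm]
  · simp

/-- In a product of matrix algebras of sizes at least two there is a self-adjoint element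
with zero diagonal whose square has diagonal one. -/
lemma exists_offDiagonal (hk : ∀ i, 2 ≤ k i) :
    ∃ w : MatrixProd k, star w = w ∧ ∑ s, diagUnit k s * w * diagUnit k s = 0 ∧
      ∑ s, diagUnit k s * (w * w) * diagUnit k s = 1 := by
  -- Each row has `k i - 1` equal nonzero entries, normalised so that their squares sum to `1`; this
  -- needs `k i ≥ 2`.
  refine ⟨fun i => Matrix.of fun a b => if a = b then 0 else ((Real.sqrt (k i - 1))⁻¹ : ℝ),
    ?_, ?_, ?_⟩
  · ext i a b
    simp only [Pi.star_apply, Matrix.star_apply, Matrix.of_apply, eq_comm (a := b)]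
    split_ifs <;> simp
  · rw [sum_diagUnit_mul_mul_diagUnit]
    ext i a b
    simp [Matrix.diagonal_apply]
  · rw [sum_diagUnit_mul_mul_diagUnit]
    ext i : 1
    rw [Pi.one_apply, ← Matrix.diagonal_one]
    congr 1
    ext a
    have hk1 : (0 : ℝ) < k i - 1 := by
      have : (2 : ℝ) ≤ k i := by exact_mod_cast hk i
      linarith
    have hsq : ((Real.sqrt (k i - 1))⁻¹ : ℝ) * ((Real.sqrt (k i - 1))⁻¹ : ℝ) = (k i - 1 : ℝ)⁻¹ := by
      rw [← mul_inv, Real.mul_self_sqrt hk1.le]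
    have hterm (b : Fin (k i)) : (if a = b then (0 : ℂ) else ((Real.sqrt (k i - 1))⁻¹ : ℝ)) *
        (if b = a then (0 : ℂ) else ((Real.sqrt (k i - 1))⁻¹ : ℝ)) =
        if b = a then (0 : ℂ) else ((k i - 1 : ℝ)⁻¹ : ℝ) := by
      by_cases h : b = a
      · simp [h]
      · rw [if_neg (Ne.symm h), if_neg h, if_neg h, ← Complex.ofReal_mul, hsq]
    simp only [Matrix.diag_apply, Pi.mul_apply, Matrix.mul_apply, Matrix.of_apply, hterm]
    rw [Finset.sum_ite, Finset.sum_const_zero, zero_add, Finset.sum_const,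
      Finset.filter_ne', Finset.card_erase_of_mem (Finset.mem_univ a), Finset.card_univ,
      Fintype.card_fin, nsmul_eq_mul, Nat.cast_sub (by have := hk i; omega)]
    have h3 : ((k i - 1 : ℝ) : ℂ) ≠ 0 := by exact_mod_cast hk1.ne'
    push_cast at h3 ⊢
    exact mul_inv_cancel₀ h3

end MatrixProducts

/-! ### From almost commuting to exactly commuting, by averaging. -/

section Averaging

variable {A : Type*} [CStarAlgebra A]

/-- The average of `x` over the inner automorphisms given by a finite group of unitaries. -/
noncomputable def unitaryAverage {G : Type*} [Group G] [Fintype G] (ρ : G →* unitary A) (x : A) : A :=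
  (Fintype.card G : ℂ)⁻¹ • ∑ g, (ρ g : A) * x * star (ρ g : A)

lemma norm_le_one_of_mem_unitary {u : A} (hu : u ∈ unitary A) : ‖u‖ ≤ 1 := by
  nontriviality A
  exact (CStarRing.norm_of_mem_unitary hu).le

/-- Conjugation by `ρ h` permutes the summands by left translation, so it fixes the average. -/
lemma commute_unitaryAverage {G : Type*} [Group G] [Fintype G] (ρ : G →* unitary A) (x : A)
    (h : G) : Commute (ρ h : A) (unitaryAverage ρ x) := by
  have key : (ρ h : A) * (∑ g, (ρ g : A) * x * star (ρ g : A)) * star (ρ h : A) =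
      ∑ g, (ρ g : A) * x * star (ρ g : A) := by
    rw [Finset.mul_sum, Finset.sum_mul]
    refine Fintype.sum_equiv (Equiv.mulLeft h) _ _ fun g => ?_
    simp [mul_assoc]
  have hu : star (ρ h : A) * (ρ h : A) = 1 := Unitary.coe_star_mul_self _
  refine Commute.smul_right ?_ _
  change _ * _ = _ * _
  conv_rhs => rw [← key]
  rw [mul_assoc, mul_assoc, hu, mul_one]

lemma isSelfAdjoint_unitaryAverage {G : Type*} [Group G] [Fintype G] (ρ : G →* unitary A) {x : A}
    (hx : IsSelfAdjoint x) : IsSelfAdjoint (unitaryAverage ρ x) := by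
  refine IsSelfAdjoint.smul (by simp [IsSelfAdjoint]) ?_
  refine isSelfAdjoint_sum _ fun g _ => hx.conjugate _

lemma norm_unitaryAverage_sub_le {G : Type*} [Group G] [Fintype G] (ρ : G →* unitary A) (x : A)
    {ε : ℝ} (h : ∀ g, ‖x * (ρ g : A) - ρ g * x‖ ≤ ε) : ‖unitaryAverage ρ x - x‖ ≤ ε := by
  have hc : (Fintype.card G : ℂ) ≠ 0 := by simp
  have hx : x = (Fintype.card G : ℂ)⁻¹ • ∑ _g : G, x := by
    rw [Finset.sum_const, Finset.card_univ, ← Nat.cast_smul_eq_nsmul ℂ, smul_smul,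
      inv_mul_cancel₀ hc, one_smul]
  have hg (g : G) : ‖(ρ g : A) * x * star (ρ g : A) - x‖ ≤ ε := by
    have h1 : (ρ g : A) * x * star (ρ g : A) - x =
        -((x * (ρ g : A) - ρ g * x) * star (ρ g : A)) := by
      have : (ρ g : A) * star (ρ g : A) = 1 := Unitary.coe_mul_star_self _
      rw [sub_mul, mul_assoc x, this, mul_one, neg_sub]
    rw [h1, norm_neg]
    calc _ ≤ ‖x * (ρ g : A) - ρ g * x‖ * ‖star (ρ g : A)‖ := norm_mul_le _ _
      _ ≤ ‖x * (ρ g : A) - ρ g * x‖ * 1 := by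
        gcongr
        rw [norm_star]; exact norm_le_one_of_mem_unitary (ρ g).2
      _ ≤ ε := by simpa using h g
  have h2 : unitaryAverage ρ x - x =
      (Fintype.card G : ℂ)⁻¹ • ∑ g, ((ρ g : A) * x * star (ρ g : A) - x) := by
    rw [Finset.sum_sub_distrib, smul_sub, ← hx]; rfl
  rw [h2, norm_smul, norm_inv, Complex.norm_natCast]
  have h3 : ‖∑ g, ((ρ g : A) * x * star (ρ g : A) - x)‖ ≤ Fintype.card G * ε := by
    refine (norm_sum_le_of_le _ fun g _ => hg g).trans ?_
    simp
  have hpos : (0 : ℝ) < Fintype.card G := by exact_mod_cast Fintype.card_pos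
  rw [inv_mul_le_iff₀ hpos]
  exact h3

/-- Since `sInf ∅ = 0` in `ℕ`, the bound on `subRank B` already forces a decomposition to exist, and
the infimum is attained. -/
lemma exists_starAlgEquiv_of_two_le_subRank {B : Type*} [Semiring B] [Algebra ℂ B] [Star B]
    (h : 2 ≤ subRank B) : ∃ (r : ℕ) (k : Fin r → ℕ), (∀ i, 2 ≤ k i) ∧
      Nonempty (B ≃⋆ₐ[ℂ] MatrixProd k) := by
  have hne : {m : ℕ | HasSubrank B m}.Nonempty :=
    Nat.nonempty_of_pos_sInf (lt_of_lt_of_le two_pos h)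
  obtain ⟨r, k, -, hiso, hleast⟩ := Nat.sInf_mem hne
  exact ⟨r, k, fun i => h.trans (hleast.2 ⟨i, rfl⟩), hiso⟩

/-- In an approximately divisible algebra, finitely many elements almost commute with a system of
orthogonal projections and a self-adjoint `w` that is off-diagonal with square of diagonal one. -/
theorem IsApproximatelyDivisible.exists_commuting (hA : IsApproximatelyDivisible A) {n : ℕ}
    (x : Fin n → A) {ε : ℝ} (hε : 0 < ε) :
    ∃ (ι : Type) (_ : Fintype ι) (e : ι → A) (w : A), CompleteOrthogonalIdempotents e ∧
      (∀ i, IsSelfAdjoint (e i)) ∧ IsSelfAdjoint w ∧ ∑ i, e i * w * e i = 0 ∧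
      ∑ i, e i * (w * w) * e i = 1 ∧
      ∀ j, ∃ y, ‖y - x j‖ ≤ ε ∧ (∀ i, Commute (e i) y) ∧ Commute w y ∧
        (IsSelfAdjoint (x j) → IsSelfAdjoint y) := by
  obtain ⟨B, -, hB, hcomm⟩ := hA n x ε hε
  obtain ⟨r, k, hk, ⟨φ⟩⟩ := exists_starAlgEquiv_of_two_le_subRank hB
  let ψ : MatrixProd k →⋆ₐ[ℂ] A := B.subtype.comp (φ.symm : MatrixProd k →⋆ₐ[ℂ] B)
  have hψB (m : MatrixProd k) : ψ m ∈ B := (φ.symm m).2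
  obtain ⟨w, hw, hw0, hw1⟩ := exists_offDiagonal hk
  have := Fintype.ofFinite (integralUnitary k)
  let ρ : integralUnitary k →* unitary A :=
    (Unitary.map { toMonoidHom := (ψ : MatrixProd k →* A), map_star' := map_star ψ } :
      unitary (MatrixProd k) →* unitary A).comp
      (integralUnitary k).subtype
  have hcom (j : Fin n) (m : MatrixProd k) : Commute (ψ m) (unitaryAverage ρ (x j)) := by
    -- The centralizer of the average is an algebra, so containing the images of the group it
    -- contains all of `ψ`'s range.
    have htop := eq_top_of_integralUnitary_le
      ((Subalgebra.centralizer ℂ {unitaryAverage ρ (x j)}).comap (ψ : MatrixProd k →ₐ[ℂ] A))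
      (fun u hu => by
        rw [Subalgebra.mem_comap, Subalgebra.mem_centralizer_iff]
        rintro _ rfl
        exact (commute_unitaryAverage ρ (x j) ⟨u, hu⟩).eq.symm)
    have hm : m ∈ (⊤ : Subalgebra ℂ (MatrixProd k)) := trivial
    rw [← htop, Subalgebra.mem_comap, Subalgebra.mem_centralizer_iff] at hm
    exact (hm _ rfl).symm
  refine ⟨Σ i, Fin (k i), inferInstance, fun s => ψ (diagUnit k s), ψ w,
    completeOrthogonalIdempotents_diagUnit.map (ψ : MatrixProd k →+* A), fun s => ?_, ?_, ?_, ?_,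
    fun j => ⟨unitaryAverage ρ (x j), ?_, fun s => hcom j _, hcom j _,
      fun h => isSelfAdjoint_unitaryAverage ρ h⟩⟩
  · rw [IsSelfAdjoint, ← map_star, diagUnit, star_matUnit]; rfl
  · rw [IsSelfAdjoint, ← map_star, hw]
  · simp only [← map_mul, ← map_sum, hw0, map_zero]
  · simp only [← map_mul, ← map_sum, hw1, map_one]
  · refine norm_unitaryAverage_sub_le ρ (x j) fun g => (hcomm j _ (hψB _) ?_).le
    exact norm_le_one_of_mem_unitary (ρ g).2

end Averaging

/-! ### Self-adjoint elements of finite spectrum: stability and spectral projections. -/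

section FiniteSpectrum

variable {A : Type*} [CStarAlgebra A]

/-- A perturbation of a self-adjoint element has nearby spectrum. -/
lemma exists_mem_spectrum_abs_sub_lt {a b : A} (ha : IsSelfAdjoint a) {η : ℝ}
    (hab : ‖b - a‖ < η) {t : ℝ} (ht : t ∈ spectrum ℝ b) : ∃ s ∈ spectrum ℝ a, |t - s| < η := by
  by_contra! hcon
  have hη : 0 < η := (norm_nonneg _).trans_lt hab
  have hne : ∀ s ∈ spectrum ℝ a, t - s ≠ 0 := fun s hs h0 => by
    have := hcon s hs
    rw [h0, abs_zero] at this
    exact absurd hη this.not_gt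
  have hcont : ContinuousOn (fun s : ℝ => (t - s)⁻¹) (spectrum ℝ a) :=
    ContinuousOn.inv₀ (by fun_prop) hne
  -- If `t` is at distance at least `η` from the spectrum of `a`, this resolvent has norm at most
  -- `η⁻¹`, so `t - b = (t - a)(1 - c(b - a))` is a product of units.
  set c := cfc (fun s : ℝ => (t - s)⁻¹) a with hc
  have hc_norm : ‖c‖ ≤ η⁻¹ := by
    refine norm_cfc_le (inv_nonneg.2 hη.le) fun s hs => ?_
    rw [norm_inv, Real.norm_eq_abs]
    exact inv_anti₀ hη (hcon s hs)
  have hta : cfc (fun s : ℝ => t - s) a = algebraMap ℝ A t - a := by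
    rw [cfc_sub (fun _ => t) (fun s => s) a, cfc_const t a, cfc_id' ℝ a]
  have hmul : (algebraMap ℝ A t - a) * c = 1 := by
    rw [← hta, hc, ← cfc_mul _ _ a (by fun_prop) hcont, ← cfc_one (R := ℝ) a]
    exact cfc_congr fun s hs => mul_inv_cancel₀ (hne s hs)
  have hmul' : c * (algebraMap ℝ A t - a) = 1 := by
    rw [← hta, hc, ← cfc_mul _ _ a hcont (by fun_prop), ← cfc_one (R := ℝ) a]
    exact cfc_congr fun s hs => inv_mul_cancel₀ (hne s hs)
  have hunit : IsUnit (algebraMap ℝ A t - a) := ⟨⟨_, c, hmul, hmul'⟩, rfl⟩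
  have hsmall : ‖c * (b - a)‖ < 1 := by
    calc ‖c * (b - a)‖ ≤ ‖c‖ * ‖b - a‖ := norm_mul_le _ _
      _ ≤ η⁻¹ * ‖b - a‖ := by gcongr
      _ < η⁻¹ * η := by gcongr
      _ = 1 := inv_mul_cancel₀ hη.ne'
  have hunit2 : IsUnit (1 - c * (b - a)) := isUnit_one_sub_of_norm_lt_one hsmall
  have h := hunit.mul hunit2
  rw [mul_sub, ← mul_assoc, hmul, mul_one, one_mul, sub_sub_sub_cancel_right] at h
  exact ht h

/-- Rounding to a finite set of reals is continuous near that set. -/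
lemma exists_rounding {S : Set ℝ} (hS : S.Finite) {ε : ℝ} (hε : 0 < ε) :
    ∃ η, 0 < η ∧ η ≤ ε ∧ ∃ f : ℝ → ℝ, ContinuousOn f {t | ∃ s ∈ S, |t - s| < η} ∧
      ∀ t, (∃ s ∈ S, |t - s| < η) → f t ∈ S ∧ |f t - t| < η := by
  classical
  obtain ⟨δ, hδ, hsep⟩ : ∃ δ > 0, ∀ s ∈ S, ∀ s' ∈ S, |s - s'| < δ → s = s' := by
    have hT := (hS.offDiag).image fun p : ℝ × ℝ => |p.1 - p.2|
    by_cases hne : ((fun p : ℝ × ℝ => |p.1 - p.2|) '' S.offDiag).Nonempty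
    · obtain ⟨δ, ⟨⟨p, q⟩, hpq, rfl⟩, hmin⟩ := Set.exists_min_image _ id hT hne
      refine ⟨|p - q|, abs_pos.2 (sub_ne_zero.2 hpq.2.2), fun s hs s' hs' h => ?_⟩
      by_contra hss
      exact absurd h (hmin _ ⟨(s, s'), ⟨hs, hs', hss⟩, rfl⟩).not_gt
    · refine ⟨1, one_pos, fun s hs s' hs' _ => ?_⟩
      by_contra hss
      exact hne ⟨_, (s, s'), ⟨hs, hs', hss⟩, rfl⟩
  -- With `δ` separating the points of `S`, at most one of them lies within `δ / 2` of `t`, so the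
  -- choice is forced and `f` is locally constant there; the value `0` elsewhere is arbitrary.
  let f : ℝ → ℝ := fun t => if h : ∃ s ∈ S, |t - s| < min ε (δ / 2) then h.choose else 0
  have hf (t : ℝ) (h : ∃ s ∈ S, |t - s| < min ε (δ / 2)) :
      f t ∈ S ∧ |f t - t| < min ε (δ / 2) := by
    have := h.choose_spec
    simp only [f, dif_pos h]
    exact ⟨this.1, by rw [abs_sub_comm]; exact this.2⟩
  refine ⟨min ε (δ / 2), by positivity, min_le_left _ _, f, ?_, hf⟩
  rintro t ⟨s, hs, hts⟩
  refine ContinuousAt.continuousWithinAt (ContinuousAt.congr (f := fun _ => s) continuousAt_const ?_)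
  have hopen : ∀ᶠ u in nhds t, |u - s| < min ε (δ / 2) :=
    (continuous_abs.comp (continuous_id.sub continuous_const)).continuousAt.eventually
      (gt_mem_nhds hts)
  filter_upwards [hopen] with u hu
  obtain ⟨h1, h2⟩ := hf u ⟨s, hs, hu⟩
  refine hsep s hs _ h1 ?_
  have h3 := min_le_right ε (δ / 2)
  calc |s - f u| = |(u - f u) - (u - s)| := by ring_nf
    _ ≤ |u - f u| + |u - s| := abs_sub _ _
    _ < δ := by rw [abs_sub_comm u]; linarith

/-- An element near a self-adjoint element of finite spectrum can be replaced, by functional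
calculus, by one of finite spectrum. -/
lemma exists_finite_spectrum_near {a : A} (ha : IsSelfAdjoint a) (hfin : (spectrum ℝ a).Finite)
    {ε : ℝ} (hε : 0 < ε) : ∃ η, 0 < η ∧ η ≤ ε ∧ ∀ b, IsSelfAdjoint b → ‖b - a‖ < η →
      ∃ c, IsSelfAdjoint c ∧ (spectrum ℝ c).Finite ∧ ‖c - b‖ ≤ ε ∧
        ∀ z, Commute z b → Commute z c := by
  obtain ⟨η, hη, hηε, f, hfc, hf⟩ := exists_rounding hfin hε
  refine ⟨η, hη, hηε, fun b hb hba => ⟨cfc f b, cfc_predicate f b, ?_, ?_,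
    fun z hz => (hz.symm.cfc (by rw [hb.star_eq]; exact hz.symm) f).symm⟩⟩
  all_goals
    have hsub : spectrum ℝ b ⊆ {t | ∃ s ∈ spectrum ℝ a, |t - s| < η} :=
      fun t ht => exists_mem_spectrum_abs_sub_lt ha hba ht
  · rw [cfc_map_spectrum f b hb (hfc.mono hsub)]
    refine hfin.subset ?_
    rintro _ ⟨t, ht, rfl⟩
    exact (hf t (hsub ht)).1
  · have h : cfc f b - b = cfc (fun t => f t - t) b := by
      rw [cfc_sub f (fun t => t) b (hfc.mono hsub), cfc_id' ℝ b]
    rw [h]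
    exact norm_cfc_le hε.le fun t ht => ((hf t (hsub ht)).2.le).trans hηε

/-- Spectral decomposition of a self-adjoint element of finite spectrum. -/
lemma exists_spectral_decomposition {a : A} (ha : IsSelfAdjoint a)
    (hfin : (spectrum ℝ a).Finite) :
    ∃ p : hfin.toFinset → A, CompleteOrthogonalIdempotents p ∧
      (∀ l, ∀ y, Commute a y → Commute (p l) y) ∧ a = ∑ l : hfin.toFinset, (l : ℝ) • p l := by
  classical
  -- A finite spectrum is discrete, so indicator functions of points are admitted by the functional
  -- calculus.
  have hcont (f : ℝ → ℝ) : ContinuousOn f (spectrum ℝ a) := hfin.continuousOn f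
  have hmul (f g : ℝ → ℝ) : cfc f a * cfc g a = cfc (fun t => f t * g t) a :=
    (cfc_mul f g a (hcont f) (hcont g)).symm
  refine ⟨fun l => cfc (fun t : ℝ => if t = l then (1 : ℝ) else 0) a, ⟨⟨fun l => ?_, fun l l' h => ?_⟩, ?_⟩,
    fun l y hy => hy.cfc (by rwa [ha.star_eq]) _, ?_⟩
  · rw [IsIdempotentElem, hmul]; simp only [mul_ite, mul_one, mul_zero, ← ite_and, and_self]
  · simp only [hmul]
    rw [← cfc_zero (R := ℝ) a]
    refine cfc_congr fun t _ => ?_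
    by_cases ht : t = l
    · have : t ≠ l' := fun h' => h (Subtype.ext (ht.symm.trans h'))
      simp [this]
    · simp [ht]
  · rw [← cfc_sum _ a _ (fun _ _ => hcont _), ← cfc_one (R := ℝ) a]
    refine cfc_congr fun t ht => ?_
    rw [Finset.sum_apply, Finset.sum_eq_single (⟨t, hfin.mem_toFinset.2 ht⟩ : hfin.toFinset)]
    · simp
    · intro l _ hl
      exact if_neg fun h => hl (Subtype.ext h.symm)
    · simp
  · conv_lhs => rw [← cfc_id' ℝ a]
    simp only [← cfc_smul _ _ a (hcont _)]
    rw [← cfc_sum _ a _ (fun _ _ => hcont _)]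
    refine cfc_congr fun t ht => ?_
    rw [Finset.sum_apply, Finset.sum_eq_single (⟨t, hfin.mem_toFinset.2 ht⟩ : hfin.toFinset)]
    · simp
    · intro l _ hl
      have : t ≠ l := fun h => hl (Subtype.ext h.symm)
      simp [this]
    · simp

section Idempotents

variable {κ : Type*} [Fintype κ] {q : κ → A}

lemma CompleteOrthogonalIdempotents.aeval_sum_smul (hq : CompleteOrthogonalIdempotents q)
    (μ : κ → ℝ) (f : Polynomial ℝ) :
    Polynomial.aeval (∑ c, μ c • q c) f = ∑ c, f.eval (μ c) • q c := by
  classical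
  have hmul (v v' : κ → ℝ) :
      (∑ c, v c • q c) * (∑ c, v' c • q c) = ∑ c, (v c * v' c) • q c := by
    rw [Finset.sum_mul]
    refine Finset.sum_congr rfl fun c _ => ?_
    rw [Finset.mul_sum, Finset.sum_eq_single c]
    · rw [smul_mul_smul_comm, (hq.idem c).eq]
    · intro c' _ hc
      rw [smul_mul_smul_comm, hq.ortho hc.symm, smul_zero]
    · simp
  induction f using Polynomial.induction_on' with
  | add f g hf hg => simp only [map_add, hf, hg, Polynomial.eval_add, add_smul, Finset.sum_add_distrib]
  | monomial n r =>
    simp only [Polynomial.aeval_monomial, Polynomial.eval_monomial, mul_smul, ← Finset.smul_sum,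
      Algebra.algebraMap_eq_smul_one, smul_mul_assoc, one_mul]
    congr 1
    induction n with
    | zero => simp [hq.complete]
    | succ n ih => rw [pow_succ, ih, hmul]; simp [pow_succ]

/-- The polynomial with roots `μ c` annihilates the element, so spectral mapping confines the
spectrum to those roots. -/
lemma CompleteOrthogonalIdempotents.finite_spectrum (hq : CompleteOrthogonalIdempotents q)
    (μ : κ → ℝ) :
    (spectrum ℝ (∑ c, μ c • q c)).Finite := by
  classical
  refine (Set.finite_range μ).subset fun t ht => ?_
  have : Nontrivial A := by
    by_contra hA
    rw [not_nontrivial_iff_subsingleton] at hA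
    simp [spectrum.of_subsingleton] at ht
  have h := spectrum.subset_polynomial_aeval (∑ c, μ c • q c)
    (∏ c, (Polynomial.X - Polynomial.C (μ c))) ⟨t, ht, rfl⟩
  rw [hq.aeval_sum_smul] at h
  have h0 : ∀ c, Polynomial.eval (μ c) (∏ c, (Polynomial.X - Polynomial.C (μ c))) = 0 := fun c => by
    rw [Polynomial.eval_prod]
    exact Finset.prod_eq_zero (Finset.mem_univ c) (by simp)
  simp only [h0, zero_smul, Finset.sum_const_zero, spectrum.zero_eq, Set.mem_singleton_iff,
    Polynomial.eval_prod, Finset.prod_eq_zero_iff] at h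
  obtain ⟨c, -, hc⟩ := h
  exact ⟨c, by simpa [sub_eq_zero, eq_comm] using hc⟩

/-- Distinct eigenvalues allow Lagrange interpolation of any prescribed coefficients `v`. -/
lemma CompleteOrthogonalIdempotents.sum_smul_mem_adjoin (hq : CompleteOrthogonalIdempotents q)
    {μ : κ → ℝ} (hμ : Function.Injective μ)
    (v : κ → ℝ) : ∑ c, v c • q c ∈ Algebra.adjoin ℝ {∑ c, μ c • q c} := by
  classical
  have h := hq.aeval_sum_smul μ (Lagrange.interpolate Finset.univ μ v)
  simp only [Lagrange.eval_interpolate_at_node v hμ.injOn (Finset.mem_univ _)] at h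
  rw [← h]
  exact Polynomial.aeval_mem_adjoin_singleton _ _

end Idempotents

end FiniteSpectrum

/-! ### The perturbation theorem that yields density. -/

section Perturbation

variable {A : Type*} [CStarAlgebra A]

lemma CompleteOrthogonalIdempotents.mul_prod {R ι κ : Type*} [Semiring R] [Fintype ι] [Fintype κ]
    {p : ι → R} {e : κ → R} (hp : CompleteOrthogonalIdempotents p)
    (he : CompleteOrthogonalIdempotents e) (hcomm : ∀ i j, Commute (p i) (e j)) :
    CompleteOrthogonalIdempotents fun c : ι × κ => p c.1 * e c.2 where
  idem c := (hp.idem c.1).mul_of_commute (hcomm _ _) (he.idem c.2)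
  ortho := by
    rintro ⟨i, j⟩ ⟨i', j'⟩ h
    dsimp only
    rw [(hcomm i' j).symm.mul_mul_mul_comm]
    by_cases hi : i = i'
    · have hj : j ≠ j' := fun hj => h (by rw [hi, hj])
      rw [he.ortho hj, mul_zero]
    · rw [hp.ortho hi, zero_mul]
  complete := by
    rw [Fintype.sum_prod_type, ← Fintype.sum_mul_sum, hp.complete, he.complete, one_mul]

/-- For all but finitely many scales `δ`, the sums `l + δ * t i` are pairwise distinct. -/
lemma exists_injective_add_mul {L ι : Type*} [Finite L] [Finite ι] {s : L → ℝ}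
    (hs : Function.Injective s) {t : ι → ℝ} (ht : Function.Injective t) {c : ℝ} (hc : 0 < c) :
    ∃ δ, 0 < δ ∧ δ < c ∧ Function.Injective fun u : L × ι => s u.1 + δ * t u.2 := by
  -- A collision with `t i ≠ t i'` forces `δ` to equal one of these finitely many quotients.
  have hbad := Set.finite_range fun u : (L × ι) × (L × ι) =>
    (s u.1.1 - s u.2.1) / (t u.2.2 - t u.1.2)
  obtain ⟨δ, ⟨h0, h1⟩, hδ⟩ := (Set.Ioo_infinite hc).exists_notMem_finite hbad
  refine ⟨δ, h0, h1, ?_⟩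
  rintro ⟨l, i⟩ ⟨l', i'⟩ h
  dsimp only at h
  by_cases hi : i = i'
  · subst hi
    rw [hs (add_right_cancel h)]
  · have hne : t i' - t i ≠ 0 := sub_ne_zero.2 fun h => hi (ht h.symm)
    refine absurd ⟨((l, i), (l', i')), ?_⟩ hδ
    rw [div_eq_iff hne]
    linear_combination h

/-- If `a` has finite spectrum and commutes with the projections `e i`, some self-adjoint
perturbation of `a` has finite spectrum and generates all the `e i`. -/
lemma exists_perturbation_generating_projections {a : A} (ha : IsSelfAdjoint a)
    (hfin : (spectrum ℝ a).Finite) {ι : Type*} [Fintype ι] {e : ι → A}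
    (he : CompleteOrthogonalIdempotents e) (hes : ∀ i, IsSelfAdjoint (e i))
    (hcomm : ∀ i, Commute (e i) a) {ε : ℝ} (hε : 0 < ε) :
    ∃ a', IsSelfAdjoint a' ∧ (spectrum ℝ a').Finite ∧ ‖a' - a‖ < ε ∧
      ∀ i, e i ∈ Algebra.adjoin ℝ {a'} := by
  classical
  obtain ⟨p, hp, hpc, hap⟩ := exists_spectral_decomposition ha hfin
  let t : ι → ℝ := fun i => (Fintype.equivFin ι i : ℕ)
  have ht : Function.Injective t := fun i j h => by
    have h' : ((Fintype.equivFin ι i : ℕ) : ℝ) = (Fintype.equivFin ι j : ℕ) := h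
    exact (Fintype.equivFin ι).injective (Fin.ext (by exact_mod_cast h'))
  set d := ∑ i, t i • e i with hd
  have hdpos : 0 < ‖d‖ + 1 := by positivity
  obtain ⟨δ, hδ0, hδ1, hinj⟩ := exists_injective_add_mul (L := hfin.toFinset)
    Subtype.val_injective ht (div_pos hε hdpos)
  -- The spectral projections of `a` commute with the `e i`; the products `p l * e i` are a common
  -- refinement on which `a + δ • d` has distinct coefficients.
  have hq := hp.mul_prod he fun l i => hpc l _ (hcomm i).symm
  have hsum : a + δ • d = ∑ c : hfin.toFinset × ι, ((c.1 : ℝ) + δ * t c.2) • (p c.1 * e c.2) := by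
    have h1 : ∑ c : hfin.toFinset × ι, (c.1 : ℝ) • (p c.1 * e c.2) = a := by
      rw [Fintype.sum_prod_type]
      simp only [← smul_mul_assoc, ← Finset.mul_sum, he.complete, mul_one]
      exact hap.symm
    have h2 : ∑ c : hfin.toFinset × ι, (δ * t c.2) • (p c.1 * e c.2) = δ • d := by
      rw [Fintype.sum_prod_type_right]
      simp only [← Finset.smul_sum, ← Finset.sum_mul, hp.complete, one_mul]
      simp only [mul_smul, ← Finset.smul_sum, hd]
    simp only [add_smul, Finset.sum_add_distrib, h1, h2]
  refine ⟨a + δ • d, ?_, ?_, ?_, fun i => ?_⟩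
  · refine ha.add (IsSelfAdjoint.smul (by simp [IsSelfAdjoint]) (isSelfAdjoint_sum _ fun i _ => ?_))
    exact IsSelfAdjoint.smul (by simp [IsSelfAdjoint]) (hes i)
  · rw [hsum]; exact hq.finite_spectrum _
  · rw [add_sub_cancel_left, norm_smul, Real.norm_of_nonneg hδ0.le]
    rw [lt_div_iff₀ hdpos] at hδ1
    linarith
  · rw [hsum]
    have h := hq.sum_smul_mem_adjoin hinj fun c => if c.2 = i then 1 else 0
    have hinner (j : ι) : ∑ l : hfin.toFinset, (if j = i then (1 : ℝ) else 0) • (p l * e j) =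
        if j = i then e j else 0 := by
      rw [← Finset.smul_sum, ← Finset.sum_mul, hp.complete, one_mul, ite_smul, one_smul, zero_smul]
    have heq : ∑ c : hfin.toFinset × ι, (if c.2 = i then (1 : ℝ) else 0) • (p c.1 * e c.2) =
        e i := by
      rw [Fintype.sum_prod_type_right]
      simp only [hinner, Finset.sum_ite_eq', Finset.mem_univ, if_true]
    exact heq ▸ h

lemma mem_of_mem_adjoin_real {S : Subalgebra ℂ A} {a z : A} (ha : a ∈ S)
    (hz : z ∈ Algebra.adjoin ℝ {a}) : z ∈ S :=
  Algebra.adjoin_le (S := S.restrictScalars ℝ) (Set.singleton_subset_iff.2 ha) hz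

/-- The square of `y` is recovered from a perturbation by an off-diagonal multiple of `y`. -/
lemma mul_self_mem_of_compression {ι : Type*} [Fintype ι] {e : ι → A} {b w y : A}
    (he : CompleteOrthogonalIdempotents e) (heb : ∀ i, Commute (e i) b)
    (hey : ∀ i, Commute (e i) y) (hwy : Commute w y) (hw0 : ∑ i, e i * w * e i = 0)
    (hw1 : ∑ i, e i * (w * w) * e i = 1) {δ : ℝ} (hδ : δ ≠ 0) {S : Subalgebra ℂ A}
    (heS : ∀ i, e i ∈ S) (hbS : b + δ • (y * w) ∈ S) : y * y ∈ S := by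
  -- Compression is linear over elements commuting with every `e i`.
  have hcompress {u v : A} (hu : ∀ i, Commute (e i) u) :
      ∑ i, e i * (u * v) * e i = u * ∑ i, e i * v * e i := by
    rw [Finset.mul_sum]
    refine Finset.sum_congr rfl fun i _ => ?_
    rw [← mul_assoc (e i), (hu i).eq]
    simp only [mul_assoc]
  have hee : ∑ i, e i * 1 * e i = 1 := by
    simp only [mul_one, (he.idem _).eq, he.complete]
  have hdiag : ∑ i, e i * (b + δ • (y * w)) * e i = b := by
    have h1 := hcompress (v := 1) heb
    rw [hee] at h1
    simp only [mul_one] at h1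
    have h2 := hcompress (v := w) hey
    rw [hw0, mul_zero] at h2
    simp only [mul_add, add_mul, Finset.sum_add_distrib, mul_smul_comm, smul_mul_assoc,
      ← Finset.smul_sum, h1, h2, smul_zero, add_zero]
  have hoff : y * w ∈ S := by
    have h : (b + δ • (y * w)) - b ∈ S := by
      refine S.sub_mem hbS ?_
      rw [← hdiag]
      exact S.sum_mem fun i _ => S.mul_mem (S.mul_mem (heS i) hbS) (heS i)
    rw [add_sub_cancel_left] at h
    have h' := S.smul_mem h ((δ⁻¹ : ℝ) : ℂ)
    rwa [Complex.coe_smul, smul_smul, inv_mul_cancel₀ hδ, one_smul] at h'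
  -- The compression of `w` vanishes and cannot return `y`, whereas that of `(y * w)² = y² * w²` is
  -- exactly `y²`.
  have h1 := hcompress (u := y * y) (v := w * w) fun i => (hey i).mul_right (hey i)
  rw [hw1, mul_one, ← (hwy.mul_mul_mul_comm y w)] at h1
  rw [← h1]
  exact S.sum_mem fun i _ => S.mul_mem (S.mul_mem (heS i) (S.mul_mem hoff hoff)) (heS i)

/-- In an approximately divisible algebra, pairs `(a, b)` with `a` of finite spectrum can be
perturbed within the same class so as to generate a given square approximately. -/
theorem IsApproximatelyDivisible.exists_perturbation (hA : IsApproximatelyDivisible A)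
    {a b x : A} (ha : IsSelfAdjoint a) (hb : IsSelfAdjoint b) (hx : IsSelfAdjoint x)
    (hfin : (spectrum ℝ a).Finite) {ε : ℝ} (hε : 0 < ε) {ε' : ℝ} (hε' : 0 < ε') :
    ∃ a' b', IsSelfAdjoint a' ∧ IsSelfAdjoint b' ∧ (spectrum ℝ a').Finite ∧ ‖a' - a‖ < ε ∧
      ‖b' - b‖ < ε ∧ ∃ z ∈ Algebra.adjoin ℂ {a', b'}, ‖z - x * x‖ < ε' := by
  have hε4 : 0 < ε / 4 := by positivity
  -- The rounding tolerance depends only on `a` and `ε`, so it can be fixed before the commuting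
  -- approximants are chosen.
  obtain ⟨η, hη, hηε, hround⟩ := exists_finite_spectrum_near ha hfin hε4
  obtain ⟨ν, hν, hsq⟩ : ∃ ν > 0, ∀ y, ‖y - x‖ < ν → ‖y * y - x * x‖ < ε' := by
    have hc : Continuous fun y : A => y * y := by fun_prop
    simpa [dist_eq_norm] using Metric.continuous_iff.1 hc x ε' hε'
  obtain ⟨ι, _, e, w, he, hes, hw, hw0, hw1, happ⟩ :=
    hA.exists_commuting ![a, b, x] (ε := min η ν / 2) (by positivity)
  have hlt : min η ν / 2 < min η ν := half_lt_self (by positivity)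
  obtain ⟨a₁, ha₁, hea, -, ha₁s⟩ := happ 0
  obtain ⟨b₁, hb₁, heb, -, hb₁s⟩ := happ 1
  obtain ⟨y, hy, hey, hwy, hys⟩ := happ 2
  simp only [Matrix.cons_val] at ha₁ ha₁s hb₁ hb₁s hy hys
  replace ha₁ := ha₁.trans_lt (hlt.trans_le (min_le_left _ _))
  replace hb₁ := hb₁.trans_lt (hlt.trans_le (min_le_left _ _))
  replace hy := hsq y (hy.trans_lt (hlt.trans_le (min_le_right _ _)))
  specialize ha₁s ha
  specialize hb₁s hb
  specialize hys hx
  obtain ⟨a₂, ha₂s, hfin₂, hf, hcomm⟩ := hround a₁ ha₁s ha₁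
  obtain ⟨a', ha's, hfin', ha', hmem⟩ := exists_perturbation_generating_projections
    ha₂s hfin₂ he hes (fun i => hcomm _ (hea i)) hε4
  obtain ⟨δ, hδ, hδε⟩ : ∃ δ : ℝ, 0 < δ ∧ δ * ‖y * w‖ < ε / 4 := by
    refine ⟨ε / 4 / (‖y * w‖ + 1), by positivity, ?_⟩
    rw [div_mul_eq_mul_div, div_lt_iff₀ (by positivity)]
    gcongr
    exact lt_add_one _
  have hyw : IsSelfAdjoint (y * w) := by
    rw [IsSelfAdjoint, star_mul, hw.star_eq, hys.star_eq, hwy.eq]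
  have heS (i : ι) : e i ∈ Algebra.adjoin ℂ {a', b₁ + δ • (y * w)} :=
    mem_of_mem_adjoin_real (Algebra.subset_adjoin (Set.mem_insert _ _)) (hmem i)
  have hyS := mul_self_mem_of_compression he heb hey hwy hw0 hw1 hδ.ne' heS
    (Algebra.subset_adjoin (Set.mem_insert_of_mem _ rfl))
  refine ⟨a', b₁ + δ • (y * w), ha's, hb₁s.add (IsSelfAdjoint.smul (by simp [IsSelfAdjoint]) hyw), hfin', ?_, ?_,
    y * y, hyS, hy⟩
  · calc ‖a' - a‖ = ‖(a' - a₂) + (a₂ - a₁) + (a₁ - a)‖ := by congr 1; abel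
      _ ≤ ‖a' - a₂‖ + ‖a₂ - a₁‖ + ‖a₁ - a‖ := norm_add₃_le
      _ < ε := by linarith
  · calc ‖b₁ + δ • (y * w) - b‖ = ‖δ • (y * w) + (b₁ - b)‖ := by congr 1; abel
      _ ≤ ‖δ • (y * w)‖ + ‖b₁ - b‖ := norm_add_le _ _
      _ < ε := by
        rw [norm_smul, Real.norm_of_nonneg hδ.le]
        linarith

end Perturbation

/-! ### Baire category, polarisation, and the passage to non-unital generation. -/

section Generation

variable {A : Type*} [CStarAlgebra A]

lemma continuous_freeAlgebra_lift {X : Type*} (p : FreeAlgebra ℂ X) :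
    Continuous fun v : X → A => FreeAlgebra.lift ℂ v p := by
  induction p using FreeAlgebra.induction with
  | grade0 r => simpa using continuous_const
  | grade1 x => simpa using continuous_apply x
  | mul p q hp hq => simp only [map_mul]; exact hp.mul hq
  | add p q hp hq => simp only [map_add]; exact hp.add hq

lemma mem_adjoin_pair_iff {v : Fin 2 → A} {z : A} :
    z ∈ Algebra.adjoin ℂ {v 0, v 1} ↔ ∃ p, FreeAlgebra.lift ℂ v p = z := by
  have hv : Set.range v = {v 0, v 1} := by
    ext z; simp [Fin.exists_fin_two, eq_comm]
  rw [← hv, Algebra.adjoin_range_eq_range_freeAlgebra_lift]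
  rfl

/-- A Baire category argument in the closure of the set of self-adjoint pairs `(a, b)` with `a` of
finite spectrum. -/
theorem IsApproximatelyDivisible.exists_forall_mul_self_mem [TopologicalSpace.SeparableSpace A]
    (hA : IsApproximatelyDivisible A) :
    ∃ a b : A, IsSelfAdjoint a ∧ IsSelfAdjoint b ∧
      ∀ c : A, (c + star c) * (c + star c) ∈ closure (Algebra.adjoin ℂ {a, b} : Set A) := by
  -- Finite spectrum need not survive limits, so Baire is applied in `closure P`; density can be
  -- tested near points of `P`, and only self-adjointness is kept for the limit pair.
  let P : Set (Fin 2 → A) :=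
    {v | IsSelfAdjoint (v 0) ∧ IsSelfAdjoint (v 1) ∧ (spectrum ℝ (v 0)).Finite}
  let y : ℕ → A := fun n =>
    (TopologicalSpace.denseSeq A n + star (TopologicalSpace.denseSeq A n)) *
      (TopologicalSpace.denseSeq A n + star (TopologicalSpace.denseSeq A n))
  let U : ℕ × ℕ → Set (closure P) := fun n =>
    {v | ∃ p, ‖FreeAlgebra.lift ℂ v.1 p - y n.1‖ < 1 / (n.2 + 1 : ℝ)}
  have hUo (n : ℕ × ℕ) : IsOpen (U n) := by
    simp only [U, Set.ofPred_exists]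
    refine isOpen_iUnion fun p => ?_
    have h : Continuous fun v : closure P => ‖FreeAlgebra.lift ℂ v.1 p - y n.1‖ :=
      (((continuous_freeAlgebra_lift p).comp continuous_subtype_val).sub continuous_const).norm
    exact isOpen_lt h continuous_const
  have hUd (n : ℕ × ℕ) : Dense (U n) := by
    rw [Metric.dense_iff]
    intro v ε hε
    obtain ⟨u, ⟨hu0, hu1, huf⟩, huv⟩ := Metric.mem_closure_iff.1 v.2 (ε / 2) (by positivity)
    obtain ⟨a', b', ha', hb', hf', hda, hdb, z, hz, hzn⟩ :=
      hA.exists_perturbation hu0 hu1 (IsSelfAdjoint.add_star_self (TopologicalSpace.denseSeq A n.1))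
        huf (half_pos hε) (ε' := 1 / (n.2 + 1 : ℝ)) (by positivity)
    have hmem : ![a', b'] ∈ P := ⟨ha', hb', hf'⟩
    refine ⟨⟨![a', b'], subset_closure hmem⟩, ?_, ?_⟩
    · rw [Metric.mem_ball, Subtype.dist_eq]
      have h1 : dist ![a', b'] u < ε / 2 := by
        rw [dist_pi_lt_iff (half_pos hε)]
        intro i
        fin_cases i
        · simpa [dist_eq_norm] using hda
        · simpa [dist_eq_norm] using hdb
      calc dist ![a', b'] (v : Fin 2 → A) ≤ dist ![a', b'] u + dist u v := dist_triangle _ _ _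
        _ < ε := by rw [dist_comm u]; linarith
    · obtain ⟨p, hp⟩ := (mem_adjoin_pair_iff (v := ![a', b'])).1 hz
      exact ⟨p, by rw [hp]; exact hzn⟩
  have : Nonempty (closure P) := by
    refine ⟨⟨0, subset_closure ⟨.zero _, .zero _, ?_⟩⟩⟩
    nontriviality A
    simp
  have : CompleteSpace (closure P) := isClosed_closure.completeSpace_coe
  obtain ⟨v, hv⟩ := (dense_iInter_of_isOpen hUo hUd).nonempty
  have hsa (i : Fin 2) : IsSelfAdjoint (v.1 i) := by
    have hcl : IsClosed {u : Fin 2 → A | star (u i) = u i} :=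
      isClosed_eq (by fun_prop) (by fun_prop)
    refine closure_minimal (fun u hu => ?_) hcl v.2
    fin_cases i
    exacts [hu.1, hu.2.1]
  refine ⟨v.1 0, v.1 1, hsa 0, hsa 1, fun c => ?_⟩
  have hy (n : ℕ) : y n ∈ closure (Algebra.adjoin ℂ {v.1 0, v.1 1} : Set A) := by
    refine Metric.mem_closure_iff.2 fun ε hε => ?_
    obtain ⟨m, hm⟩ := exists_nat_one_div_lt hε
    obtain ⟨p, hp⟩ := Set.mem_iInter.1 hv (n, m)
    refine ⟨_, mem_adjoin_pair_iff.2 ⟨p, rfl⟩, ?_⟩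
    rw [dist_comm, dist_eq_norm]
    exact hp.trans hm
  have hcl : IsClosed ((fun c : A => (c + star c) * (c + star c)) ⁻¹'
      closure (Algebra.adjoin ℂ {v.1 0, v.1 1} : Set A)) :=
    isClosed_closure.preimage (by fun_prop)
  have huniv := (TopologicalSpace.denseRange_denseSeq A).closure_range
  have hsub := closure_minimal (s := Set.range (TopologicalSpace.denseSeq A))
    (Set.range_subset_iff.2 hy) hcl
  rw [huniv] at hsub
  exact hsub trivial

/-- Polarisation against the unit: for self-adjoint `x`, `(2 + 2x)² - (2 - 2x)² = 16x`. -/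
lemma eq_top_of_forall_mul_self_mem (S : Subalgebra ℂ A)
    (hS : ∀ c : A, (c + star c) * (c + star c) ∈ S) : S = ⊤ := by
  have hsa (x : A) (hx : IsSelfAdjoint x) : x ∈ S := by
    have h1 := hS (1 + x)
    have h2 := hS (1 - x)
    have h3 := S.smul_mem (S.sub_mem h1 h2) (1 / 16 : ℂ)
    convert h3 using 1
    simp only [star_add, star_sub, star_one, hx.star_eq]
    have : (1 + x + (1 + x)) * (1 + x + (1 + x)) - (1 - x + (1 - x)) * (1 - x + (1 - x)) =
        (16 : ℂ) • x := by
      rw [ofNat_smul_eq_nsmul]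
      noncomm_ring
    rw [this, smul_smul]
    norm_num
  refine eq_top_iff.2 fun x _ => ?_
  rw [← realPart_add_I_smul_imaginaryPart x]
  exact S.add_mem (hsa _ (realPart x).2) (S.smul_mem (hsa _ (imaginaryPart x).2) _)

lemma isClosed_cstarGenerated (S : Set A) : IsClosed (cstarGenerated S : Set A) :=
  NonUnitalStarSubalgebra.isClosed_topologicalClosure _

lemma subset_cstarGenerated (S : Set A) : S ⊆ cstarGenerated S :=
  (NonUnitalStarAlgebra.subset_adjoin ℂ S).trans
    (NonUnitalStarSubalgebra.le_topologicalClosure _)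

/-- A closed subalgebra containing an element at distance less than one from `1` contains `1`. -/
lemma one_mem_of_norm_one_sub_lt_one {C : NonUnitalStarSubalgebra ℂ A} (hC : IsClosed (C : Set A))
    {h : A} (hh : h ∈ C) (hlt : ‖1 - h‖ < 1) : (1 : A) ∈ C := by
  -- These are polynomials in `h` without constant term, and they converge to `1`.
  have hmem (n : ℕ) : 1 - (1 - h) ^ n ∈ C := by
    induction n with
    | zero => simp
    | succ n ih =>
      have : 1 - (1 - h) ^ (n + 1) = (1 - (1 - h) ^ n) + (h - (1 - (1 - h) ^ n) * h) := by
        rw [pow_succ]; noncomm_ring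
      rw [this]
      exact add_mem ih (sub_mem hh (mul_mem ih hh))
  have hlim : Filter.Tendsto (fun n : ℕ => 1 - (1 - h) ^ n) Filter.atTop (nhds (1 - 0)) :=
    tendsto_const_nhds.sub (tendsto_pow_atTop_nhds_zero_of_norm_lt_one hlt)
  rw [sub_zero] at hlim
  exact hC.mem_of_tendsto hlim (Filter.Eventually.of_forall hmem)

/-- A unital algebra generated by two self-adjoint elements is also generated by two self-adjoint
elements as a non-unital C*-algebra. -/
lemma exists_cstarGenerated_eq_top_of_adjoin {a b : A} (ha : IsSelfAdjoint a)
    (h : closure (Algebra.adjoin ℂ {a, b} : Set A) = Set.univ) :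
    ∃ a' : A, IsSelfAdjoint a' ∧ cstarGenerated ({a', b} : Set A) = ⊤ := by
  -- Replacing `a` by `1 + η a`, within distance less than one of `1`, makes the unit available in
  -- the non-unital closed algebra, and then `a` itself.
  obtain ⟨η, hη, hηa⟩ : ∃ η : ℝ, 0 < η ∧ η * ‖a‖ < 1 := by
    refine ⟨(‖a‖ + 1)⁻¹, by positivity, ?_⟩
    rw [inv_mul_lt_iff₀ (by positivity), mul_one]
    exact lt_add_one _
  refine ⟨1 + η • a, (IsSelfAdjoint.one A).add (IsSelfAdjoint.smul (by simp [IsSelfAdjoint]) ha), ?_⟩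
  set C := cstarGenerated ({1 + η • a, b} : Set A)
  have hC : IsClosed (C : Set A) := isClosed_cstarGenerated _
  have hsub := subset_cstarGenerated ({1 + η • a, b} : Set A)
  have hh : 1 + η • a ∈ C := hsub (Set.mem_insert _ _)
  have hb : b ∈ C := hsub (Set.mem_insert_of_mem _ rfl)
  have h1 : (1 : A) ∈ C := by
    refine one_mem_of_norm_one_sub_lt_one hC hh ?_
    rwa [sub_add_cancel_left, norm_neg, norm_smul, Real.norm_of_nonneg hη.le]
  have haC : a ∈ C := by
    have h2 := C.toSubmodule.smul_mem (η⁻¹ : ℂ) (sub_mem hh h1)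
    rwa [add_sub_cancel_left, ← Complex.coe_smul, smul_smul, inv_mul_cancel₀, one_smul] at h2
    exact_mod_cast hη.ne'
  have hadj : (Algebra.adjoin ℂ {a, b} : Set A) ⊆ C := by
    intro z hz
    induction hz using Algebra.adjoin_induction with
    | mem x hx =>
      rcases hx with rfl | rfl
      exacts [haC, hb]
    | algebraMap r => rw [Algebra.algebraMap_eq_smul_one]; exact C.toSubmodule.smul_mem r h1
    | add x y _ _ hx hy => exact add_mem hx hy
    | mul x y _ _ hx hy => exact mul_mem hx hy
  have htop := closure_minimal hadj hC
  rw [h] at htop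
  exact eq_top_iff.2 fun x _ => htop trivial

/-- The generator is `a + i b`; its real and imaginary parts return `a` and `b`. -/
lemma isSinglyGenerated_of_pair {a b : A} (ha : IsSelfAdjoint a) (hb : IsSelfAdjoint b)
    (h : cstarGenerated ({a, b} : Set A) = ⊤) : IsSinglyGenerated A := by
  refine ⟨a + Complex.I • b, eq_top_iff.2 ?_⟩
  set x := a + Complex.I • b with hx
  have hxC : x ∈ cstarGenerated ({x} : Set A) := subset_cstarGenerated _ rfl
  have hstar : star x = a - Complex.I • b := by
    simp [hx, ha.star_eq, hb.star_eq, sub_eq_add_neg]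
  have hsC := star_mem hxC
  rw [← h]
  refine NonUnitalStarSubalgebra.topologicalClosure_minimal _
    (NonUnitalStarAlgebra.adjoin_le ?_) (isClosed_cstarGenerated _)
  rintro _ (rfl | rfl)
  · have h1 := (cstarGenerated ({x} : Set A)).toSubmodule.smul_mem (1 / 2 : ℂ) (add_mem hxC hsC)
    rw [hstar, hx, add_add_sub_cancel, ← two_smul ℂ, smul_smul] at h1
    norm_num at h1
    exact h1
  · have h1 := (cstarGenerated ({x} : Set A)).toSubmodule.smul_mem (-Complex.I / 2 : ℂ)
      (sub_mem hxC hsC)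
    rw [hstar, hx, add_sub_sub_cancel, ← two_smul ℂ, smul_smul, smul_smul,
      show -Complex.I / 2 * 2 * Complex.I = 1 by ring_nf; simp, one_smul] at h1
    exact h1

end Generation

theorem theorem3p1 (A : Type*) [CStarAlgebra A] [TopologicalSpace.SeparableSpace A]
    (hA : IsApproximatelyDivisible A) :
    IsSinglyGenerated A ∧
      ∃ a b : A, IsSelfAdjoint a ∧ IsSelfAdjoint b ∧
        cstarGenerated ({a, b} : Set A) = ⊤ := by
  obtain ⟨a, b, ha, hb, hab⟩ := hA.exists_forall_mul_self_mem
  have htop := eq_top_of_forall_mul_self_mem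
    (Algebra.adjoin ℂ {a, b} : Subalgebra ℂ A).topologicalClosure hab
  have hcl : closure (Algebra.adjoin ℂ {a, b} : Set A) = Set.univ := congrArg SetLike.coe htop
  obtain ⟨a', ha', h⟩ := exists_cstarGenerated_eq_top_of_adjoin ha hcl
  exact ⟨isSinglyGenerated_of_pair ha' hb h, a', b, ha', hb, h⟩
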